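/- Let $k$ be an algebraically closed field of characteristic $0$, and let $$A=k\langle g,x,y \mid gx=-xg,\ gy=-yg,\ xy=-yx,\ g^2=1,\ x^2=y^2=0\rangle ,$$ an algebra of dimension $8$ over $k$, with the Hopf algebra structure determined by $$\Delta(g)=g\otimes g,\quad \Delta(x)=x\otimes g+1\otimes x,\quad \Delta(y)=y\otimes g+1\otimes y,$$ $$\varepsilon(g)=1,\quad \varepsilon(x)=\varepsilon(y)=0,\qquad S(g)=g,\quad S(x)=gx,\quad S(y)=gy .$$ For a Hopf algebra automorphism $\tau$ of $A$ and an integer $m\ge 1$ with $\tau^m=1$, the $m$-th $\tau$-twisted Frobenius-Schur indicator of $A$ is the trace $$\nu_{m,\tau}(A)=\operatorname{Tr}(S\circ P_{m-1,\tau}),\qquad P_{m-1,\tau}(a)=\sum \tau^{m-1}(a_1)\,\tau^{m-2}(a_2)\cdots\tau(a_{m-1})$$ (Sweedler notation, with $P_{0,\tau}(a)=\varepsilon(a)1$). Every Hopf algebra automorphism $\tau$ of $A$ is given on the span of $x$ and $y$ by a unique matrix, that is, there is a unique $\begin{pmatrix} a&b\\c&d\end{pmatrix}$ over $k$ with $\tau(x)=ax+by$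 and $\tau(y)=cx+dy$, and this matrix is invertible. Write $\det\tau=ad-bc$ and $\operatorname{tr}\tau=a+d$. (1) If $\tau^2=1$ and $m$ is an even positive integer, then $\nu_{m,\tau}(A)=\frac{m^2}{2}\,(1+\det\tau)$. Moreover $\det \tau=\pm1$, and consequently $\nu_{m,\tau}(A)=m^2$ if $\det\tau=1$, while $\nu_{m,\tau}(A)=0$ if $\det\tau=-1$. (2) If $\tau^3=1$, then $\nu_{3,\tau}(A)=(\operatorname{tr}\tau+\det\tau)^2+(\operatorname{tr}\tau+1)(1-\det\tau)$. Consequently $\nu_{3,\tau}(A)=9$ if $\tau=\mathrm{id}$, and $\nu_{3,\tau}(A)=0$ if $\tau\ne\mathrm{id}$. -/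

import Mathlib

open scoped TensorProduct

noncomputable section

universe u v

section TwistedIndicator

variable {k : Type u} {H : Type v} [CommRing k] [Ring H] [HopfAlgebra k H]

/-- The `n`-fold iterate of a Hopf algebra automorphism `τ`, as a linear map. -/
def twistIter (τ : H ≃ₐc[k] H) : ℕ → (H →ₗ[k] H)
  | 0 => LinearMap.id
  | n + 1 => (τ : H →ₐ[k] H).toLinearMap ∘ₗ twistIter τ n

/-- The variant `P_{n,τ}` of the twisted Hopf power map, with `n` factors:
`P_{n,τ}(a) = ∑ τⁿ(a₁) τⁿ⁻¹(a₂) ⋯ τ(aₙ)` in Sweedler notation. It is given by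
`P_{0,τ}(a) = ε(a) 1` (no factors) and `P_{n+1,τ}(a) = ∑ τⁿ⁺¹(a₁) P_{n,τ}(a₂)`. -/
def twistedPowerMap (τ : H ≃ₐc[k] H) : ℕ → (H →ₗ[k] H)
  | 0 => Algebra.linearMap k H ∘ₗ Coalgebra.counit
  | n + 1 => LinearMap.mul' k H ∘ₗ
      TensorProduct.map (twistIter τ (n + 1)) (twistedPowerMap τ n) ∘ₗ Coalgebra.comul

/-- The `m`-th twisted Frobenius-Schur indicator `ν_{m,τ}(H) = Tr (S ∘ P_{m-1,τ})`, for `m ≥ 1`. -/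
def twistedIndicator (m : ℕ) (τ : H ≃ₐc[k] H) : k :=
  LinearMap.trace k H (HopfAlgebra.antipode k ∘ₗ twistedPowerMap τ (m - 1))

end TwistedIndicator

namespace Pointed8

/-- The names of the three generators `g`, `x`, `y`. -/
inductive Gen : Type
  | g | x | y

section

variable (k : Type u) [CommRing k]

/-- The relations `gx = -xg`, `gy = -yg`, `xy = -yx`, `g² = 1`, `x² = y² = 0` in the free
algebra `k⟨g, x, y⟩`. -/
inductive Rel : FreeAlgebra k Gen → FreeAlgebra k Gen → Prop
  | gx : Rel (FreeAlgebra.ι k Gen.g * FreeAlgebra.ι k Gen.x)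
      (-(FreeAlgebra.ι k Gen.x * FreeAlgebra.ι k Gen.g))
  | gy : Rel (FreeAlgebra.ι k Gen.g * FreeAlgebra.ι k Gen.y)
      (-(FreeAlgebra.ι k Gen.y * FreeAlgebra.ι k Gen.g))
  | xy : Rel (FreeAlgebra.ι k Gen.x * FreeAlgebra.ι k Gen.y)
      (-(FreeAlgebra.ι k Gen.y * FreeAlgebra.ι k Gen.x))
  | gg : Rel (FreeAlgebra.ι k Gen.g * FreeAlgebra.ι k Gen.g) 1
  | xx : Rel (FreeAlgebra.ι k Gen.x * FreeAlgebra.ι k Gen.x) 0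
  | yy : Rel (FreeAlgebra.ι k Gen.y * FreeAlgebra.ι k Gen.y) 0

/-- The algebra `A = k⟨g, x, y | gx = -xg, gy = -yg, xy = -yx, g² = 1, x² = y² = 0⟩`. -/
def A : Type u := RingQuot (Rel k)

instance : Ring (A k) := inferInstanceAs (Ring (RingQuot (Rel k)))

instance : Algebra k (A k) := inferInstanceAs (Algebra k (RingQuot (Rel k)))

/-- The image of a generator in `A`. -/
def gen (i : Gen) : A k := RingQuot.mkAlgHom k (Rel k) (FreeAlgebra.ι k i)

/-- The generator `g` of `A`. -/
abbrev g : A k := gen k Gen.g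

/-- The generator `x` of `A`. -/
abbrev x : A k := gen k Gen.x

/-- The generator `y` of `A`. -/
abbrev y : A k := gen k Gen.y

theorem gen_mul (i j : Gen) : gen k i * gen k j =
    RingQuot.mkAlgHom k (Rel k) (FreeAlgebra.ι k i * FreeAlgebra.ι k j) :=
  (map_mul (RingQuot.mkAlgHom k (Rel k)) _ _).symm

theorem g_mul_x : g k * x k = -(x k * g k) := by
  rw [gen_mul, gen_mul, RingQuot.mkAlgHom_rel k Rel.gx]; exact map_neg _ _

theorem g_mul_y : g k * y k = -(y k * g k) := by
  rw [gen_mul, gen_mul, RingQuot.mkAlgHom_rel k Rel.gy]; exact map_neg _ _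

theorem x_mul_y : x k * y k = -(y k * x k) := by
  rw [gen_mul, gen_mul, RingQuot.mkAlgHom_rel k Rel.xy]; exact map_neg _ _

theorem g_mul_g : g k * g k = 1 := by
  rw [gen_mul, RingQuot.mkAlgHom_rel k Rel.gg]; exact map_one _

theorem x_mul_x : x k * x k = 0 := by
  rw [gen_mul, RingQuot.mkAlgHom_rel k Rel.xx]; exact map_zero _

theorem y_mul_y : y k * y k = 0 := by
  rw [gen_mul, RingQuot.mkAlgHom_rel k Rel.yy]; exact map_zero _

variable {k}

/-- Three elements of an algebra satisfying the defining relations of `A`. -/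
structure Good {B : Type v} [Ring B] (a b c : B) : Prop where
  gx : a * b = -(b * a)
  gy : a * c = -(c * a)
  xy : b * c = -(c * b)
  gg : a * a = 1
  xx : b * b = 0
  yy : c * c = 0

/-- The universal property of the presentation: three elements that satisfy the relations
define an algebra homomorphism from `A`. -/
def lift {B : Type v} [Ring B] [Algebra k B] (a b c : B) (h : Good a b c) : A k →ₐ[k] B :=
  RingQuot.liftAlgHom k (s := Rel k)
    ⟨FreeAlgebra.lift k (fun i => Gen.rec a b c i), by
      intro p q hpq
      cases hpq <;> simp [h.gx, h.gy, h.xy, h.gg, h.xx, h.yy]⟩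

section lift

variable {B : Type v} [Ring B] [Algebra k B] (a b c : B) (h : Good a b c)

@[simp] theorem lift_g : lift (k := k) a b c h (gen k Gen.g) = a := by
  unfold lift gen
  exact (RingQuot.liftAlgHom_mkAlgHom_apply k _ _ _).trans (by simp)

@[simp] theorem lift_x : lift (k := k) a b c h (gen k Gen.x) = b := by
  unfold lift gen
  exact (RingQuot.liftAlgHom_mkAlgHom_apply k _ _ _).trans (by simp)

@[simp] theorem lift_y : lift (k := k) a b c h (gen k Gen.y) = c := by
  unfold lift gen
  exact (RingQuot.liftAlgHom_mkAlgHom_apply k _ _ _).trans (by simp)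

end lift

theorem algHom_ext {B : Type v} [Semiring B] [Algebra k B] {f f' : A k →ₐ[k] B}
    (hg : f (gen k Gen.g) = f' (gen k Gen.g)) (hx : f (gen k Gen.x) = f' (gen k Gen.x))
    (hy : f (gen k Gen.y) = f' (gen k Gen.y)) : f = f' := by
  refine RingQuot.ringQuot_ext' (S := k) (s := Rel k) f f' (FreeAlgebra.hom_ext ?_)
  funext i
  cases i
  · exact hg
  · exact hx
  · exact hy

/-- Induction along the generators. -/
theorem gen_induction {P : A k → Prop} (hg : P (g k)) (hx : P (x k)) (hy : P (y k))
    (hc : ∀ r : k, P (algebraMap k (A k) r)) (hadd : ∀ a b, P a → P b → P (a + b))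
    (hmul : ∀ a b, P a → P b → P (a * b)) (a : A k) : P a := by
  obtain ⟨p, rfl⟩ := RingQuot.mkAlgHom_surjective k (Rel k) a
  induction p using FreeAlgebra.induction with
  | grade0 r =>
    have h := AlgHom.commutes (RingQuot.mkAlgHom k (Rel k)) r
    rw [h]
    exact hc r
  | grade1 i =>
    cases i
    · exact hg
    · exact hx
    · exact hy
  | mul p q hp hq => rw [map_mul]; exact hmul _ _ hp hq
  | add p q hp hq => rw [map_add]; exact hadd _ _ hp hq

variable (k)

/-- The comultiplication: `Δ(g) = g ⊗ g`, `Δ(x) = x ⊗ g + 1 ⊗ x`, `Δ(y) = y ⊗ g + 1 ⊗ y`. -/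
def comulHom : A k →ₐ[k] A k ⊗[k] A k :=
  lift (g k ⊗ₜ g k) (x k ⊗ₜ g k + 1 ⊗ₜ x k) (y k ⊗ₜ g k + 1 ⊗ₜ y k) <| by
    constructor <;>
    simp only [mul_add, add_mul, Algebra.TensorProduct.tmul_mul_tmul, g_mul_x, g_mul_y, x_mul_y,
      g_mul_g, x_mul_x, y_mul_y, one_mul, mul_one, TensorProduct.neg_tmul, TensorProduct.tmul_neg,
      TensorProduct.zero_tmul, TensorProduct.tmul_zero, Algebra.TensorProduct.one_def] <;>
    abel

/-- The counit: `ε(g) = 1`, `ε(x) = ε(y) = 0`. -/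
def counitHom : A k →ₐ[k] k :=
  lift 1 0 0 <| by constructor <;> simp

/-- The antipode as an algebra homomorphism to the opposite algebra:
`S(g) = g`, `S(x) = gx`, `S(y) = gy`. -/
def antipodeHom : A k →ₐ[k] (A k)ᵐᵒᵖ :=
  lift (MulOpposite.op (g k)) (MulOpposite.op (g k * x k)) (MulOpposite.op (g k * y k)) <| by
    have e1 : ∀ a b : A k, g k * a * (g k * b) = g k * (a * g k) * b := by
      intro a b; simp only [mul_assoc]
    have ex : x k * g k = -(g k * x k) := by rw [g_mul_x, neg_neg]
    have ey : y k * g k = -(g k * y k) := by rw [g_mul_y, neg_neg]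
    have eg : ∀ a : A k, g k * (g k * a) = a := by
      intro a; rw [← mul_assoc, g_mul_g, one_mul]
    constructor <;> apply MulOpposite.unop_injective <;>
    simp only [MulOpposite.unop_mul, MulOpposite.unop_op, MulOpposite.unop_neg,
      MulOpposite.unop_one, MulOpposite.unop_zero, e1, ex, ey, mul_neg, neg_mul, eg, g_mul_g,
      mul_assoc, x_mul_x, y_mul_y, x_mul_y, neg_neg, neg_zero]

instance : Bialgebra k (A k) :=
  Bialgebra.ofAlgHom (comulHom k) (counitHom k)
    (by
      apply algHom_ext <;>
      simp [comulHom, TensorProduct.add_tmul, TensorProduct.tmul_add,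
        Algebra.TensorProduct.one_def, add_assoc])
    (by apply algHom_ext <;> simp [comulHom, counitHom])
    (by apply algHom_ext <;> simp [comulHom, counitHom])

/-- The antipode as a linear map. -/
def antipodeLin : A k →ₗ[k] A k :=
  (MulOpposite.opLinearEquiv k).symm.toLinearMap ∘ₗ (antipodeHom k).toLinearMap

theorem antipodeLin_apply (a : A k) : antipodeLin k a = (antipodeHom k a).unop := rfl

theorem antipodeLin_mul (a b : A k) :
    antipodeLin k (a * b) = antipodeLin k b * antipodeLin k a := by
  simp [antipodeLin_apply]

theorem antipode_left_mul (t : A k ⊗[k] A k) (r : k)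
    (ht : LinearMap.mul' k (A k) ((antipodeLin k).rTensor (A k) t) = algebraMap k (A k) r)
    (u : A k ⊗[k] A k) :
    LinearMap.mul' k (A k) ((antipodeLin k).rTensor (A k) (t * u)) =
      algebraMap k (A k) r * LinearMap.mul' k (A k) ((antipodeLin k).rTensor (A k) u) := by
  induction u with
  | zero => simp
  | add u v hu hv => simp only [mul_add, map_add, hu, hv]
  | tmul c d =>
    have : LinearMap.mul' k (A k) ((antipodeLin k).rTensor (A k) (t * c ⊗ₜ[k] d)) =
        antipodeLin k c * LinearMap.mul' k (A k) ((antipodeLin k).rTensor (A k) t) * d := by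
      clear ht
      induction t with
      | zero => simp
      | add u v hu hv => simp only [mul_add, add_mul, map_add, hu, hv]
      | tmul e f => simp [antipodeLin_mul, mul_assoc]
    rw [this, ht, ← Algebra.commutes]
    simp [mul_assoc]

theorem antipode_right_mul (t : A k ⊗[k] A k) (r : k)
    (ht : LinearMap.mul' k (A k) ((antipodeLin k).lTensor (A k) t) = algebraMap k (A k) r)
    (u : A k ⊗[k] A k) :
    LinearMap.mul' k (A k) ((antipodeLin k).lTensor (A k) (u * t)) =
      LinearMap.mul' k (A k) ((antipodeLin k).lTensor (A k) u) * algebraMap k (A k) r := by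
  induction u with
  | zero => simp
  | add u v hu hv => simp only [add_mul, map_add, hu, hv]
  | tmul c d =>
    have : LinearMap.mul' k (A k) ((antipodeLin k).lTensor (A k) (c ⊗ₜ[k] d * t)) =
        c * LinearMap.mul' k (A k) ((antipodeLin k).lTensor (A k) t) * antipodeLin k d := by
      clear ht
      induction t with
      | zero => simp
      | add u v hu hv => simp only [mul_add, add_mul, map_add, hu, hv]
      | tmul e f => simp [antipodeLin_mul, mul_assoc]
    rw [this, ht, mul_assoc, Algebra.commutes]
    simp [mul_assoc]

theorem comul_eq (a : A k) : Coalgebra.comul (R := k) a = comulHom k a := rfl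

theorem counit_eq (a : A k) : Coalgebra.counit (R := k) a = counitHom k a := rfl

theorem antipode_left (a : A k) :
    LinearMap.mul' k (A k) ((antipodeLin k).rTensor (A k) (comulHom k a)) =
      algebraMap k (A k) (counitHom k a) := by
  induction a using gen_induction with
  | hg => simp [comulHom, counitHom, antipodeLin_apply, antipodeHom, g_mul_g]
  | hx =>
    simp [comulHom, counitHom, antipodeLin_apply, antipodeHom, mul_assoc]
    rw [← mul_assoc, g_mul_x]; simp [mul_assoc, g_mul_g]
  | hy =>
    simp [comulHom, counitHom, antipodeLin_apply, antipodeHom, mul_assoc]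
    rw [← mul_assoc, g_mul_y]; simp [mul_assoc, g_mul_g]
  | hc r => simp [Algebra.TensorProduct.algebraMap_apply, antipodeLin_apply]
  | hadd a b ha hb => simp only [map_add, ha, hb]
  | hmul a b ha hb => rw [map_mul, antipode_left_mul k _ _ ha, hb, map_mul, map_mul]

theorem antipode_right (a : A k) :
    LinearMap.mul' k (A k) ((antipodeLin k).lTensor (A k) (comulHom k a)) =
      algebraMap k (A k) (counitHom k a) := by
  induction a using gen_induction with
  | hg => simp [comulHom, counitHom, antipodeLin_apply, antipodeHom, g_mul_g]
  | hx => simp [comulHom, counitHom, antipodeLin_apply, antipodeHom, g_mul_x]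
  | hy => simp [comulHom, counitHom, antipodeLin_apply, antipodeHom, g_mul_y]
  | hc r => simp [Algebra.TensorProduct.algebraMap_apply, antipodeLin_apply]
  | hadd a b ha hb => simp only [map_add, ha, hb]
  | hmul a b ha hb => rw [map_mul, antipode_right_mul k _ _ hb, ha, map_mul, map_mul]

instance : HopfAlgebra k (A k) where
  antipode := antipodeLin k
  mul_antipode_rTensor_comul := LinearMap.ext (antipode_left k)
  mul_antipode_lTensor_comul := LinearMap.ext (antipode_right k)

variable {k}

/-- `M = (a b; c d)` is the matrix of `τ` on the span of `x` and `y`: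
`τ(x) = a x + b y` and `τ(y) = c x + d y`. -/
def IsMatrixOf (τ : A k ≃ₐc[k] A k) (M : Matrix (Fin 2) (Fin 2) k) : Prop :=
  τ (x k) = M 0 0 • x k + M 0 1 • y k ∧ τ (y k) = M 1 0 • x k + M 1 1 • y k

end

end Pointed8

end

/-! The algebra acts on `k^8` by the matrices that left multiplication should have on the monomials
`1, x, y, xy, g, gx, gy, gxy`. This makes the monomials a basis (`monomialBasis`), so the dimension
is 8 and traces can be read off from coordinates.

The group-likes of `A` are `1` and `g`, so an automorphism `τ` fixes `g`. It then permutes the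
elements `w` with `Δ(w) = w ⊗ g + 1 ⊗ w` that anticommute with `g`, and these form the span of `x`
and `y`. Hence `τ` is determined by a 2×2 matrix `M`, it multiplies `xy` by `det M`, and composition
becomes matrix multiplication (`IsMatrixOf.mul`, `IsMatrixOf.eq_iff`).

The coproducts of the monomials give recursions in `n` for `P_{n,τ}`. If `τ² = 1` and `m = 2(p+1)`,
they solve in closed form: in `Tr(S ∘ P)` the monomials `1, g` contribute 1 each, `x, y, gx, gy`
contribute `p` each, and `xy, gxy` contribute `p² + (p+1)² det M` each. The sum is `2(p+1)²(1 + det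
M) = (m²/2)(1 + det M)`. For `m = 3` two steps of the recursion give the polynomial in `tr M` and
`det M`; its vanishing when `M³ = 1` and `M ≠ 1` follows from Cayley–Hamilton
(`indicator_polynomial_eq_zero`). -/

namespace Pointed8

/-! ### The monomial basis and the trace in coordinates. -/

section Basis

variable (k : Type u) [CommRing k]

/-- This rule and the next ones rewrite words to the normal form with `g` before `x` before `y`. The
`_mul` variants apply inside right-associated products. -/
theorem x_mul_g : x k * g k = -(g k * x k) := by rw [g_mul_x, neg_neg]

theorem y_mul_g : y k * g k = -(g k * y k) := by rw [g_mul_y, neg_neg]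

theorem y_mul_x : y k * x k = -(x k * y k) := by rw [x_mul_y, neg_neg]

theorem g_mul_g_mul (z : A k) : g k * (g k * z) = z := by
  rw [← mul_assoc, g_mul_g, one_mul]

theorem x_mul_x_mul (z : A k) : x k * (x k * z) = 0 := by
  rw [← mul_assoc, x_mul_x, zero_mul]

theorem x_mul_g_mul (z : A k) : x k * (g k * z) = -(g k * (x k * z)) := by
  rw [← mul_assoc, x_mul_g, neg_mul, mul_assoc]

theorem y_mul_g_mul (z : A k) : y k * (g k * z) = -(g k * (y k * z)) := by
  rw [← mul_assoc, y_mul_g, neg_mul, mul_assoc]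

theorem y_mul_x_mul (z : A k) : y k * (x k * z) = -(x k * (y k * z)) := by
  rw [← mul_assoc, y_mul_x, neg_mul, mul_assoc]

/-- Left multiplication by `g` in the coordinates of the monomial basis
`1, x, y, xy, g, gx, gy, gxy`. -/
noncomputable def leftG : Module.End k (Fin 8 → k) where
  toFun v := ![v 4, v 5, v 6, v 7, v 0, v 1, v 2, v 3]
  map_add' v w := by ext i; fin_cases i <;> simp
  map_smul' r v := by ext i; fin_cases i <;> simp

/-- Left multiplication by `x` in the coordinates of the monomial basis. -/
noncomputable def leftX : Module.End k (Fin 8 → k) where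
  toFun v := ![0, v 0, 0, v 2, 0, -v 4, 0, -v 6]
  map_add' v w := by ext i; fin_cases i <;> simp [add_comm]
  map_smul' r v := by ext i; fin_cases i <;> simp

/-- Left multiplication by `y` in the coordinates of the monomial basis. -/
noncomputable def leftY : Module.End k (Fin 8 → k) where
  toFun v := ![0, 0, v 0, -v 1, 0, 0, -v 4, v 5]
  map_add' v w := by ext i; fin_cases i <;> simp [add_comm]
  map_smul' r v := by ext i; fin_cases i <;> simp

theorem leftG_apply (v : Fin 8 → k) :
    leftG k v = ![v 4, v 5, v 6, v 7, v 0, v 1, v 2, v 3] := rfl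

theorem leftX_apply (v : Fin 8 → k) :
    leftX k v = ![0, v 0, 0, v 2, 0, -v 4, 0, -v 6] := rfl

theorem leftY_apply (v : Fin 8 → k) :
    leftY k v = ![0, 0, v 0, -v 1, 0, 0, -v 4, v 5] := rfl

theorem good_left : Good (leftG k) (leftX k) (leftY k) := by
  constructor <;> refine LinearMap.ext fun v => funext fun i => ?_ <;> fin_cases i <;>
    simp [leftG_apply, leftX_apply, leftY_apply]

/-- The left regular representation of `A`, in the coordinates of the monomial basis. -/
noncomputable def leftRep : A k →ₐ[k] Module.End k (Fin 8 → k) :=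
  lift (leftG k) (leftX k) (leftY k) (good_left k)

theorem leftRep_g : leftRep k (g k) = leftG k := by simp [leftRep]

theorem leftRep_x : leftRep k (x k) = leftX k := by simp [leftRep]

theorem leftRep_y : leftRep k (y k) = leftY k := by simp [leftRep]

/-- The coordinates of an element of `A` in the monomial basis. -/
noncomputable def coord : A k →ₗ[k] (Fin 8 → k) :=
  (LinearMap.applyₗ ![1, 0, 0, 0, 0, 0, 0, 0]) ∘ₗ (leftRep k).toLinearMap

theorem coord_apply (a : A k) : coord k a = leftRep k a ![1, 0, 0, 0, 0, 0, 0, 0] := rfl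

theorem coord_one : coord k 1 = ![1, 0, 0, 0, 0, 0, 0, 0] := by simp [coord_apply]

theorem coord_x : coord k (x k) = ![0, 1, 0, 0, 0, 0, 0, 0] := by
  simp [coord_apply, leftRep_x, leftX_apply]

theorem coord_y : coord k (y k) = ![0, 0, 1, 0, 0, 0, 0, 0] := by
  simp [coord_apply, leftRep_y, leftY_apply]

theorem coord_xy : coord k (x k * y k) = ![0, 0, 0, 1, 0, 0, 0, 0] := by
  simp [coord_apply, leftRep_x, leftX_apply, leftRep_y, leftY_apply]

theorem coord_g : coord k (g k) = ![0, 0, 0, 0, 1, 0, 0, 0] := by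
  simp [coord_apply, leftRep_g, leftG_apply]

theorem coord_gx : coord k (g k * x k) = ![0, 0, 0, 0, 0, 1, 0, 0] := by
  simp [coord_apply, leftRep_g, leftG_apply, leftRep_x, leftX_apply]

theorem coord_gy : coord k (g k * y k) = ![0, 0, 0, 0, 0, 0, 1, 0] := by
  simp [coord_apply, leftRep_g, leftG_apply, leftRep_y, leftY_apply]

theorem coord_gxy : coord k (g k * (x k * y k)) = ![0, 0, 0, 0, 0, 0, 0, 1] := by
  simp [coord_apply, leftRep_g, leftG_apply, leftRep_x, leftX_apply, leftRep_y, leftY_apply]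

/-- The linear combination of the monomials with given coefficients. -/
noncomputable def ofCoord (v : Fin 8 → k) : A k :=
  v 0 • 1 + v 1 • x k + v 2 • y k + v 3 • (x k * y k) + v 4 • g k + v 5 • (g k * x k) +
    v 6 • (g k * y k) + v 7 • (g k * (x k * y k))

/-- `ofCoord` intertwines the representation with left multiplication. Evaluated at the coordinate
vector of `1`, this shows that the monomials span. -/
theorem ofCoord_leftRep (a : A k) (v : Fin 8 → k) :
    ofCoord k (leftRep k a v) = a * ofCoord k v := by
  induction a using gen_induction generalizing v with
  | hg =>
    simp only [leftRep_g, leftG_apply, ofCoord, mul_add, mul_smul_comm, g_mul_g_mul, g_mul_g,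
      mul_one]
    simp
    abel
  | hx =>
    simp only [leftRep_x, leftX_apply, ofCoord, mul_add, mul_smul_comm, x_mul_g_mul, x_mul_g,
      x_mul_x, x_mul_x_mul, mul_one]
    simp
  | hy =>
    simp only [leftRep_y, leftY_apply, ofCoord, mul_add, mul_smul_comm, y_mul_g_mul, y_mul_g,
      y_mul_x, y_mul_x_mul, y_mul_y, mul_one]
    simp
  | hc r =>
    simp only [AlgHom.commutes, Module.algebraMap_end_apply, ← Algebra.smul_def]
    simp [ofCoord, mul_smul]
  | hadd a b ha hb =>
    rw [map_add, add_mul, ← ha, ← hb]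
    simp only [ofCoord, LinearMap.add_apply, Pi.add_apply, add_smul]
    abel
  | hmul a b ha hb => rw [map_mul, mul_assoc, ← hb, ← ha, Module.End.mul_apply]

theorem ofCoord_coord (a : A k) : ofCoord k (coord k a) = a := by
  rw [coord_apply, ofCoord_leftRep]
  simp [ofCoord]

/-- This half gives the linear independence of the monomials. -/
theorem coord_ofCoord (v : Fin 8 → k) : coord k (ofCoord k v) = v := by
  simp only [ofCoord, map_add, map_smul, coord_one, coord_x, coord_y, coord_xy, coord_g,
    coord_gx, coord_gy, coord_gxy]
  ext i
  fin_cases i <;> simp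

/-- The monomial basis `1, x, y, xy, g, gx, gy, gxy` of `A`. -/
noncomputable def monomialBasis : Module.Basis (Fin 8) k (A k) :=
  Module.Basis.ofEquivFun
    { coord k with
      invFun := ofCoord k
      left_inv := ofCoord_coord k
      right_inv := coord_ofCoord k }

theorem monomialBasis_repr (a : A k) (i : Fin 8) : (monomialBasis k).repr a i = coord k a i := by
  simp [monomialBasis]

theorem monomialBasis_apply (i : Fin 8) :
    monomialBasis k i = ofCoord k (Pi.single i 1) := by
  rw [monomialBasis, Module.Basis.coe_ofEquivFun]
  rfl

theorem trace_eq (f : A k →ₗ[k] A k) :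
    LinearMap.trace k (A k) f = coord k (f 1) 0 + coord k (f (x k)) 1 + coord k (f (y k)) 2 +
      coord k (f (x k * y k)) 3 + coord k (f (g k)) 4 + coord k (f (g k * x k)) 5 +
      coord k (f (g k * y k)) 6 + coord k (f (g k * (x k * y k))) 7 := by
  rw [LinearMap.trace_eq_matrix_trace k (monomialBasis k), Matrix.trace]
  simp [Fin.sum_univ_eight, LinearMap.toMatrix_apply, monomialBasis_repr, monomialBasis_apply,
    ofCoord, Pi.single_apply]

end Basis

/-! ### Coproduct and antipode on the monomials. -/

section Comul

variable (k : Type u) [CommRing k]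

theorem comulHom_g : comulHom k (g k) = g k ⊗ₜ g k := by simp [comulHom]

theorem comulHom_x : comulHom k (x k) = x k ⊗ₜ g k + 1 ⊗ₜ x k := by simp [comulHom]

theorem comulHom_y : comulHom k (y k) = y k ⊗ₜ g k + 1 ⊗ₜ y k := by simp [comulHom]

theorem comulHom_xy : comulHom k (x k * y k) =
    (x k * y k) ⊗ₜ 1 + x k ⊗ₜ (g k * y k) - y k ⊗ₜ (g k * x k) + 1 ⊗ₜ (x k * y k) := by
  simp [comulHom_x, comulHom_y, mul_add, add_mul, g_mul_g, x_mul_g, TensorProduct.tmul_neg]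
  abel

theorem comulHom_gx : comulHom k (g k * x k) = (g k * x k) ⊗ₜ 1 + g k ⊗ₜ (g k * x k) := by
  simp [comulHom_x, comulHom_g, mul_add, g_mul_g]

theorem comulHom_gy : comulHom k (g k * y k) = (g k * y k) ⊗ₜ 1 + g k ⊗ₜ (g k * y k) := by
  simp [comulHom_y, comulHom_g, mul_add, g_mul_g]

theorem comulHom_gxy : comulHom k (g k * (x k * y k)) =
    (g k * (x k * y k)) ⊗ₜ g k + (g k * x k) ⊗ₜ y k - (g k * y k) ⊗ₜ x k +
      g k ⊗ₜ (g k * (x k * y k)) := by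
  rw [map_mul, comulHom_xy, comulHom_g]
  simp [mul_add, mul_sub, g_mul_g_mul]

theorem antipode_x : antipodeLin k (x k) = g k * x k := by
  simp [antipodeLin_apply, antipodeHom]

theorem antipode_y : antipodeLin k (y k) = g k * y k := by
  simp [antipodeLin_apply, antipodeHom]

theorem antipode_g : antipodeLin k (g k) = g k := by
  simp [antipodeLin_apply, antipodeHom]

theorem antipode_one : antipodeLin k (1 : A k) = 1 := by
  simp [antipodeLin_apply]

theorem antipode_gx : antipodeLin k (g k * x k) = - x k := by
  rw [antipodeLin_mul, antipode_x, antipode_g, mul_assoc, x_mul_g, mul_neg, g_mul_g_mul]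

theorem antipode_gy : antipodeLin k (g k * y k) = - y k := by
  rw [antipodeLin_mul, antipode_y, antipode_g, mul_assoc, y_mul_g, mul_neg, g_mul_g_mul]

theorem antipode_xy : antipodeLin k (x k * y k) = x k * y k := by
  simp only [antipodeLin_mul, antipode_y, antipode_x, mul_assoc, y_mul_g_mul, mul_neg,
    g_mul_g_mul, y_mul_x, neg_neg]

theorem antipode_gxy : antipodeLin k (g k * (x k * y k)) = g k * (x k * y k) := by
  simp only [antipodeLin_mul _ (g k), antipode_xy, antipode_g, mul_assoc, y_mul_g, mul_neg,
    x_mul_g_mul, neg_neg]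

/-- The antipode sends `x` to `gx` and `gx` to `-x`, and likewise for `y`, while it fixes `1, g, xy,
gxy`. So the four middle monomials enter through swapped coordinates with a sign. -/
theorem trace_antipode_comp (f : A k →ₗ[k] A k) :
    LinearMap.trace k (A k) (HopfAlgebra.antipode k ∘ₗ f) =
      coord k (f 1) 0 - coord k (f (x k)) 5 - coord k (f (y k)) 6 +
      coord k (f (x k * y k)) 3 + coord k (f (g k)) 4 + coord k (f (g k * x k)) 1 +
      coord k (f (g k * y k)) 2 + coord k (f (g k * (x k * y k))) 7 := by
  have h : ∀ a, coord k (HopfAlgebra.antipode k a) =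
      ![coord k a 0, -coord k a 5, -coord k a 6, coord k a 3, coord k a 4, coord k a 1,
        coord k a 2, coord k a 7] := by
    intro a
    change coord k (antipodeLin k a) = _
    conv_lhs => rw [← ofCoord_coord k a]
    simp only [ofCoord, map_add, map_smul, antipode_one, antipode_x, antipode_y, antipode_xy,
      antipode_g, antipode_gx, antipode_gy, antipode_gxy, map_neg, coord_one, coord_x, coord_y,
      coord_xy, coord_g, coord_gx, coord_gy, coord_gxy]
    ext i
    fin_cases i <;> simp
  rw [trace_eq]
  simp [h]
  ring

end Comul

/-! ### Automorphisms of `A` as 2×2 matrices. -/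

section Automorphism

variable {k : Type u} [Field k]

/-- The coefficient of `eᵢ ⊗ eⱼ` of a tensor, for the monomial basis `e`. -/
noncomputable def coord₂ (i j : Fin 8) : A k ⊗[k] A k →ₗ[k] k :=
  LinearMap.mul' k k ∘ₗ TensorProduct.map (LinearMap.proj i ∘ₗ coord k) (LinearMap.proj j ∘ₗ coord k)

theorem coord₂_tmul (i j : Fin 8) (a b : A k) :
    coord₂ i j (a ⊗ₜ b) = coord k a i * coord k b j := by simp [coord₂]

theorem coord₂_comulHom (i j : Fin 8) (a : A k) :
    coord₂ i j (comulHom k a) =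
      coord k a 0 * coord₂ i j (1 ⊗ₜ 1) + coord k a 1 * coord₂ i j (comulHom k (x k)) +
      coord k a 2 * coord₂ i j (comulHom k (y k)) +
      coord k a 3 * coord₂ i j (comulHom k (x k * y k)) +
      coord k a 4 * coord₂ i j (comulHom k (g k)) +
      coord k a 5 * coord₂ i j (comulHom k (g k * x k)) +
      coord k a 6 * coord₂ i j (comulHom k (g k * y k)) +
      coord k a 7 * coord₂ i j (comulHom k (g k * (x k * y k))) := by
  conv_lhs => rw [← ofCoord_coord k a]
  simp only [ofCoord, map_add, map_smul, smul_eq_mul, map_one, Algebra.TensorProduct.one_def]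

theorem counitHom_eq_coord (a : A k) : counitHom k a = coord k a 0 + coord k a 4 := by
  conv_lhs => rw [← ofCoord_coord k a]
  simp [ofCoord, counitHom]

theorem one_ne_g : (1 : A k) ≠ g k := by
  intro h
  have := congrFun (congrArg (coord k) h) 0
  simp [coord_one, coord_g] at this

/-- For a monomial `e` other than `1` and `g`, the tensor `e ⊗ e` occurs in no coproduct, so the
square of the coefficient of `e` in `u` is zero. Since `1 ⊗ g` does not occur either, one of the
coefficients of `1` and `g` vanishes, and the counit makes the other equal to 1. -/
theorem eq_one_or_eq_g_of_comulHom {u : A k} (hu : comulHom k u = u ⊗ₜ u)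
    (hε : counitHom k u = 1) : u = 1 ∨ u = g k := by
  have key : ∀ i j, coord₂ i j (comulHom k u) = coord k u i * coord k u j := by
    intro i j; rw [hu, coord₂_tmul]
  rw [counitHom_eq_coord] at hε
  have h00 := key 0 0
  have h04 := key 0 4
  have h11 := key 1 1
  have h22 := key 2 2
  have h33 := key 3 3
  have h55 := key 5 5
  have h66 := key 6 6
  have h77 := key 7 7
  rw [coord₂_comulHom] at h00 h04 h11 h22 h33 h55 h66 h77
  simp [comulHom_x, comulHom_y, comulHom_xy, comulHom_g, comulHom_gx, comulHom_gy, comulHom_gxy,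
    coord₂_tmul, coord_one, coord_x, coord_y, coord_xy, coord_g, coord_gx, coord_gy,
    coord_gxy] at h00 h04 h11 h22 h33 h55 h66 h77
  rw [← ofCoord_coord k u]
  rcases h04 with h | h
  · rw [h, zero_add] at hε
    right
    simp [ofCoord, h, hε, h11, h22, h33, h55, h66, h77]
  · rw [h, add_zero] at hε
    left
    simp [ofCoord, h, hε, h11, h22, h33, h55, h66, h77]

theorem comulHom_map (τ : A k ≃ₐc[k] A k) (a : A k) :
    comulHom k (τ a) = TensorProduct.map (τ : A k →ₐ[k] A k).toLinearMap
      (τ : A k →ₐ[k] A k).toLinearMap (comulHom k a) :=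
  (CoalgHomClass.map_comp_comul_apply τ a).symm

theorem counitHom_map (τ : A k ≃ₐc[k] A k) (a : A k) : counitHom k (τ a) = counitHom k a :=
  CoalgHomClass.counit_comp_apply τ a

theorem map_g (τ : A k ≃ₐc[k] A k) : τ (g k) = g k := by
  refine (eq_one_or_eq_g_of_comulHom ?_ ?_).resolve_left fun h => one_ne_g (k := k) ?_
  · rw [comulHom_map, comulHom_g]; rfl
  · rw [counitHom_map]; simp [counitHom]
  · apply EquivLike.injective τ
    rw [h, map_one]

/-- The coproduct condition alone would also allow `1 - g`. Anticommutation with `g` kills the four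
monomials that commute with `g`, as `2` is invertible. -/
theorem eq_smul_x_add_smul_y [CharZero k] {w : A k} (hg : g k * w = -(w * g k))
    (hw : comulHom k w = w ⊗ₜ g k + 1 ⊗ₜ w) :
    w = coord k w 1 • x k + coord k w 2 • y k := by
  -- The coefficients of `gx ⊗ 1` and `gy ⊗ 1` show that `gx` and `gy` do not occur in `w`.
  have h50 := congrArg (coord₂ 5 0) hw
  have h60 := congrArg (coord₂ 6 0) hw
  rw [coord₂_comulHom] at h50 h60
  simp [comulHom_x, comulHom_y, comulHom_xy, comulHom_g, comulHom_gx, comulHom_gy, comulHom_gxy,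
    coord₂_tmul, coord_one, coord_x, coord_y, coord_xy, coord_g, coord_gx, coord_gy,
    coord_gxy] at h50 h60
  have h : coord k (g k * w) + coord k (w * g k) = 0 := by rw [hg]; simp
  conv at h => lhs; rw [← ofCoord_coord k w]
  simp only [ofCoord, mul_add, add_mul, mul_smul_comm, smul_mul_assoc, mul_one, one_mul, g_mul_g,
    g_mul_g_mul, x_mul_g, x_mul_g_mul, y_mul_g, mul_assoc, mul_neg, neg_neg, map_add, map_smul,
    map_neg, coord_one, coord_x, coord_y, coord_xy, coord_g, coord_gx, coord_gy, coord_gxy] at h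
  have e0 := congrFun h 0
  have e3 := congrFun h 3
  have e4 := congrFun h 4
  have e7 := congrFun h 7
  simp at e0 e3 e4 e7
  conv_lhs => rw [← ofCoord_coord k w]
  simp [ofCoord, h50, h60, e0, e3, e4, e7]

theorem comulHom_map_x (τ : A k ≃ₐc[k] A k) :
    comulHom k (τ (x k)) = τ (x k) ⊗ₜ g k + 1 ⊗ₜ τ (x k) := by
  rw [comulHom_map, comulHom_x]
  simp [map_g]

theorem comulHom_map_y (τ : A k ≃ₐc[k] A k) :
    comulHom k (τ (y k)) = τ (y k) ⊗ₜ g k + 1 ⊗ₜ τ (y k) := by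
  rw [comulHom_map, comulHom_y]
  simp [map_g]

theorem smul_x_add_smul_y_inj {a b c d : k}
    (h : a • x k + b • y k = c • x k + d • y k) : a = c ∧ b = d := by
  have := congrArg (coord k) h
  simp only [map_add, map_smul, coord_x, coord_y] at this
  have h1 := congrFun this 1
  have h2 := congrFun this 2
  simp at h1 h2
  exact ⟨h1, h2⟩

theorem existsUnique_isMatrixOf [CharZero k] (τ : A k ≃ₐc[k] A k) :
    ∃! M : Matrix (Fin 2) (Fin 2) k, IsMatrixOf τ M := by
  have hx : τ (x k) = _ := eq_smul_x_add_smul_y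
    (by rw [← map_g τ, ← map_mul, g_mul_x, map_neg, map_mul]) (comulHom_map_x τ)
  have hy : τ (y k) = _ := eq_smul_x_add_smul_y
    (by rw [← map_g τ, ← map_mul, g_mul_y, map_neg, map_mul]) (comulHom_map_y τ)
  refine ⟨!![coord k (τ (x k)) 1, coord k (τ (x k)) 2; coord k (τ (y k)) 1, coord k (τ (y k)) 2],
    ⟨hx, hy⟩, fun N hN => ?_⟩
  obtain ⟨h00, h01⟩ := smul_x_add_smul_y_inj (hN.1.symm.trans hx)
  obtain ⟨h10, h11⟩ := smul_x_add_smul_y_inj (hN.2.symm.trans hy)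
  rw [← h00, ← h01, ← h10, ← h11]
  exact Matrix.eta_fin_two N

theorem IsMatrixOf.map_xy {τ : A k ≃ₐc[k] A k} {M : Matrix (Fin 2) (Fin 2) k}
    (h : IsMatrixOf τ M) : τ (x k * y k) = M.det • (x k * y k) := by
  rw [map_mul, h.1, h.2, Matrix.det_fin_two]
  simp only [mul_add, add_mul, mul_smul_comm, smul_mul_assoc, x_mul_x, y_mul_y, y_mul_x]
  module

theorem smul_xy_inj {a b : k} (h : a • (x k * y k) = b • (x k * y k)) : a = b := by
  have := congrFun (congrArg (coord k) h) 3
  simpa [coord_xy] using this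

theorem IsMatrixOf.det_ne_zero {τ : A k ≃ₐc[k] A k} {M : Matrix (Fin 2) (Fin 2) k}
    (h : IsMatrixOf τ M) : M.det ≠ 0 := by
  intro h0
  have h1 : τ (x k * y k) = τ 0 := by rw [h.map_xy, h0, zero_smul, map_zero]
  have h2 : (1 : k) • (x k * y k) = (0 : k) • (x k * y k) := by
    rw [one_smul, zero_smul]; exact EquivLike.injective τ h1
  exact one_ne_zero (smul_xy_inj h2)

/-- The rows of the matrix hold the images of `x` and `y`, so applying `τ` first puts `M` on the
left. -/
theorem IsMatrixOf.mul {τ σ : A k ≃ₐc[k] A k} {M N : Matrix (Fin 2) (Fin 2) k}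
    (h : IsMatrixOf τ M) (h' : IsMatrixOf σ N) : IsMatrixOf (τ.trans σ) (M * N) := by
  constructor
  · change σ (τ (x k)) = _
    rw [h.1, map_add, map_smul, map_smul, h'.1, h'.2]
    simp only [Matrix.mul_apply, Fin.sum_univ_two]
    module
  · change σ (τ (y k)) = _
    rw [h.2, map_add, map_smul, map_smul, h'.1, h'.2]
    simp only [Matrix.mul_apply, Fin.sum_univ_two]
    module

theorem isMatrixOf_refl : IsMatrixOf (BialgEquiv.refl k (A k)) 1 := by
  constructor <;> simp

theorem IsMatrixOf.eq_iff {τ σ : A k ≃ₐc[k] A k} {M N : Matrix (Fin 2) (Fin 2) k}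
    (h : IsMatrixOf τ M) (h' : IsMatrixOf σ N) : τ = σ ↔ M = N := by
  constructor
  · rintro rfl
    obtain ⟨h00, h01⟩ := smul_x_add_smul_y_inj (h.1.symm.trans h'.1)
    obtain ⟨h10, h11⟩ := smul_x_add_smul_y_inj (h.2.symm.trans h'.2)
    ext i j
    fin_cases i <;> fin_cases j <;> assumption
  · rintro rfl
    have : (τ : A k →ₐ[k] A k) = σ := by
      apply algHom_ext
      · exact (map_g τ).trans (map_g σ).symm
      · exact h.1.trans h'.1.symm
      · exact h.2.trans h'.2.symm
    exact DFunLike.ext _ _ fun a => DFunLike.congr_fun this a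

end Automorphism

/-! ### Recursions for the twisted power maps. -/

section PowerMap

variable {k : Type u} [Field k] (τ : A k ≃ₐc[k] A k)

theorem twistIter_succ_apply (n : ℕ) (a : A k) : twistIter τ (n + 1) a = τ (twistIter τ n a) := rfl

theorem twistIter_mul (n : ℕ) (a b : A k) :
    twistIter τ n (a * b) = twistIter τ n a * twistIter τ n b := by
  induction n with
  | zero => rfl
  | succ n ih => rw [twistIter_succ_apply, ih, map_mul]; rfl

theorem twistIter_one (n : ℕ) : twistIter τ n 1 = 1 := by
  induction n with
  | zero => rfl
  | succ n ih => rw [twistIter_succ_apply, ih, map_one]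

theorem twistIter_g (n : ℕ) : twistIter τ n (g k) = g k := by
  induction n with
  | zero => rfl
  | succ n ih => rw [twistIter_succ_apply, ih, map_g]

theorem twistIter_even (h : τ.trans τ = BialgEquiv.refl k (A k)) (p : ℕ) :
    twistIter τ (2 * p) = LinearMap.id := by
  induction p with
  | zero => rfl
  | succ p ih =>
    ext a
    exact ((congrArg (fun f => τ (τ (f a))) ih).trans (DFunLike.congr_fun h a))

theorem twistedPowerMap_succ_apply (n : ℕ) (a : A k) :
    twistedPowerMap τ (n + 1) a = LinearMap.mul' k (A k)
      (TensorProduct.map (twistIter τ (n + 1)) (twistedPowerMap τ n) (comulHom k a)) := rfl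

variable (n : ℕ)

theorem twistedPowerMap_one : twistedPowerMap τ n 1 = 1 := by
  induction n with
  | zero => simp [twistedPowerMap]
  | succ n ih =>
    rw [twistedPowerMap_succ_apply, map_one, Algebra.TensorProduct.one_def]
    simp [ih, twistIter_one]

theorem twistedPowerMap_succ_g :
    twistedPowerMap τ (n + 1) (g k) = g k * twistedPowerMap τ n (g k) := by
  rw [twistedPowerMap_succ_apply, comulHom_g]
  simp [twistIter_g]

theorem twistedPowerMap_succ_x : twistedPowerMap τ (n + 1) (x k) =
    twistIter τ (n + 1) (x k) * twistedPowerMap τ n (g k) + twistedPowerMap τ n (x k) := by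
  rw [twistedPowerMap_succ_apply, comulHom_x]
  simp [twistIter_one]

theorem twistedPowerMap_succ_y : twistedPowerMap τ (n + 1) (y k) =
    twistIter τ (n + 1) (y k) * twistedPowerMap τ n (g k) + twistedPowerMap τ n (y k) := by
  rw [twistedPowerMap_succ_apply, comulHom_y]
  simp [twistIter_one]

theorem twistedPowerMap_succ_gx : twistedPowerMap τ (n + 1) (g k * x k) =
    g k * twistIter τ (n + 1) (x k) + g k * twistedPowerMap τ n (g k * x k) := by
  rw [twistedPowerMap_succ_apply, comulHom_gx]
  simp [twistIter_mul, twistIter_g, twistedPowerMap_one]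

theorem twistedPowerMap_succ_gy : twistedPowerMap τ (n + 1) (g k * y k) =
    g k * twistIter τ (n + 1) (y k) + g k * twistedPowerMap τ n (g k * y k) := by
  rw [twistedPowerMap_succ_apply, comulHom_gy]
  simp [twistIter_mul, twistIter_g, twistedPowerMap_one]

theorem twistedPowerMap_succ_xy : twistedPowerMap τ (n + 1) (x k * y k) =
    twistIter τ (n + 1) (x k * y k) +
      twistIter τ (n + 1) (x k) * twistedPowerMap τ n (g k * y k) -
      twistIter τ (n + 1) (y k) * twistedPowerMap τ n (g k * x k) +
      twistedPowerMap τ n (x k * y k) := by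
  rw [twistedPowerMap_succ_apply, comulHom_xy]
  simp [twistIter_one, twistedPowerMap_one]

theorem twistedPowerMap_succ_gxy : twistedPowerMap τ (n + 1) (g k * (x k * y k)) =
    g k * twistIter τ (n + 1) (x k * y k) * twistedPowerMap τ n (g k) +
      g k * (twistIter τ (n + 1) (x k) * twistedPowerMap τ n (y k)) -
      g k * (twistIter τ (n + 1) (y k) * twistedPowerMap τ n (x k)) +
      g k * twistedPowerMap τ n (g k * (x k * y k)) := by
  rw [twistedPowerMap_succ_apply, comulHom_gxy]
  simp [twistIter_mul, twistIter_g, mul_assoc]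

end PowerMap

/-! ### Closed forms and the indicator when `τ² = 1`. -/

section Involution

variable {k : Type u} [Field k] {τ : A k ≃ₐc[k] A k} {M : Matrix (Fin 2) (Fin 2) k}

theorem twistIter_odd (h : τ.trans τ = BialgEquiv.refl k (A k)) (p : ℕ) (a : A k) :
    twistIter τ (2 * p + 1) a = τ a := by
  rw [twistIter_succ_apply, twistIter_even τ h, LinearMap.id_apply]

theorem twistIter_odd_succ (h : τ.trans τ = BialgEquiv.refl k (A k)) (p : ℕ) (a : A k) :
    twistIter τ (2 * p + 1 + 1) a = a := by
  rw [show 2 * p + 1 + 1 = 2 * (p + 1) by ring, twistIter_even τ h, LinearMap.id_apply]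

theorem twistedPowerMap_even_g (p : ℕ) : twistedPowerMap τ (2 * p) (g k) = 1 := by
  induction p with
  | zero => simp [twistedPowerMap, counit_eq, counitHom]
  | succ p ih =>
    rw [show 2 * (p + 1) = 2 * p + 1 + 1 by ring, twistedPowerMap_succ_g, twistedPowerMap_succ_g,
      ih, mul_one, g_mul_g]

theorem twistedPowerMap_odd_g (p : ℕ) : twistedPowerMap τ (2 * p + 1) (g k) = g k := by
  rw [twistedPowerMap_succ_g, twistedPowerMap_even_g, mul_one]

theorem twistedPowerMap_zero_of_counit {a : A k} (ha : counitHom k a = 0) :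
    twistedPowerMap τ 0 a = 0 := by
  simp [twistedPowerMap, counit_eq, ha]

theorem counitHom_x : counitHom k (x k) = 0 := by simp [counitHom]

theorem counitHom_y : counitHom k (y k) = 0 := by simp [counitHom]

/-- Two steps of the recursion add `τ(x)` from the odd step and `xg = -gx` from the even one. -/
theorem twistedPowerMap_even_x (h : τ.trans τ = BialgEquiv.refl k (A k)) (p : ℕ) :
    twistedPowerMap τ (2 * p) (x k) = (p : k) • (τ (x k) - g k * x k) := by
  induction p with
  | zero => simp [twistedPowerMap_zero_of_counit counitHom_x]
  | succ p ih =>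
    rw [show 2 * (p + 1) = 2 * p + 1 + 1 by ring, twistedPowerMap_succ_x, twistedPowerMap_succ_x,
      ih, twistIter_odd h, twistIter_odd_succ h, twistedPowerMap_odd_g, twistedPowerMap_even_g,
      x_mul_g, mul_one, Nat.cast_succ]
    module

theorem twistedPowerMap_even_y (h : τ.trans τ = BialgEquiv.refl k (A k)) (p : ℕ) :
    twistedPowerMap τ (2 * p) (y k) = (p : k) • (τ (y k) - g k * y k) := by
  induction p with
  | zero => simp [twistedPowerMap_zero_of_counit counitHom_y]
  | succ p ih =>
    rw [show 2 * (p + 1) = 2 * p + 1 + 1 by ring, twistedPowerMap_succ_y, twistedPowerMap_succ_y,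
      ih, twistIter_odd h, twistIter_odd_succ h, twistedPowerMap_odd_g, twistedPowerMap_even_g,
      y_mul_g, mul_one, Nat.cast_succ]
    module

theorem twistedPowerMap_odd_x (h : τ.trans τ = BialgEquiv.refl k (A k)) (p : ℕ) :
    twistedPowerMap τ (2 * p + 1) (x k) = (p + 1 : k) • τ (x k) - (p : k) • (g k * x k) := by
  rw [twistedPowerMap_succ_x, twistedPowerMap_even_x h, twistIter_odd h, twistedPowerMap_even_g,
    mul_one]
  module

theorem twistedPowerMap_odd_y (h : τ.trans τ = BialgEquiv.refl k (A k)) (p : ℕ) :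
    twistedPowerMap τ (2 * p + 1) (y k) = (p + 1 : k) • τ (y k) - (p : k) • (g k * y k) := by
  rw [twistedPowerMap_succ_y, twistedPowerMap_even_y h, twistIter_odd h, twistedPowerMap_even_g,
    mul_one]
  module

theorem twistedPowerMap_even_gx (h : τ.trans τ = BialgEquiv.refl k (A k)) (p : ℕ) :
    twistedPowerMap τ (2 * p) (g k * x k) = (p : k) • (τ (x k) + g k * x k) := by
  induction p with
  | zero => simp [twistedPowerMap_zero_of_counit, counitHom_x]
  | succ p ih =>
    rw [show 2 * (p + 1) = 2 * p + 1 + 1 by ring, twistedPowerMap_succ_gx,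
      twistedPowerMap_succ_gx, ih, twistIter_odd h, twistIter_odd_succ h, mul_add, g_mul_g_mul,
      g_mul_g_mul, Nat.cast_succ]
    module

theorem twistedPowerMap_even_gy (h : τ.trans τ = BialgEquiv.refl k (A k)) (p : ℕ) :
    twistedPowerMap τ (2 * p) (g k * y k) = (p : k) • (τ (y k) + g k * y k) := by
  induction p with
  | zero => simp [twistedPowerMap_zero_of_counit, counitHom_y]
  | succ p ih =>
    rw [show 2 * (p + 1) = 2 * p + 1 + 1 by ring, twistedPowerMap_succ_gy,
      twistedPowerMap_succ_gy, ih, twistIter_odd h, twistIter_odd_succ h, mul_add, g_mul_g_mul,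
      g_mul_g_mul, Nat.cast_succ]
    module

theorem twistedPowerMap_odd_gx (h : τ.trans τ = BialgEquiv.refl k (A k)) (p : ℕ) :
    twistedPowerMap τ (2 * p + 1) (g k * x k) =
      (p + 1 : k) • (g k * τ (x k)) + (p : k) • x k := by
  rw [twistedPowerMap_succ_gx, twistedPowerMap_even_gx h, twistIter_odd h, mul_smul_comm, mul_add,
    g_mul_g_mul]
  module

theorem twistedPowerMap_odd_gy (h : τ.trans τ = BialgEquiv.refl k (A k)) (p : ℕ) :
    twistedPowerMap τ (2 * p + 1) (g k * y k) =
      (p + 1 : k) • (g k * τ (y k)) + (p : k) • y k := by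
  rw [twistedPowerMap_succ_gy, twistedPowerMap_even_gy h, twistIter_odd h, mul_smul_comm, mul_add,
    g_mul_g_mul]
  module

/-- The increments are products of `x, y` or their images with the values on `gx` and `gy`, which
are linear in `p`; hence the quadratic coefficients. The trace comes from `x τ(y) - y τ(x) = (tr M)
xy`. Its term lies along `gxy` and does not contribute to the indicator. -/
theorem twistedPowerMap_odd_xy (h : τ.trans τ = BialgEquiv.refl k (A k)) (hM : IsMatrixOf τ M)
    (p : ℕ) : twistedPowerMap τ (2 * p + 1) (x k * y k) =
      (p ^ 2 + (p + 1) ^ 2 * M.det : k) • (x k * y k) -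
        (p * (p + 1) * M.trace : k) • (g k * (x k * y k)) := by
  induction p with
  | zero =>
    rw [twistedPowerMap_succ_xy, twistIter_odd h, hM.map_xy]
    simp [twistedPowerMap_zero_of_counit, counitHom_x, counitHom_y]
  | succ p ih =>
    rw [twistedPowerMap_succ_xy, twistIter_odd h, twistIter_odd h, twistIter_odd h, hM.map_xy,
      twistedPowerMap_even_gx h, twistedPowerMap_even_gy h, hM.1, hM.2,
      show 2 * (p + 1) = 2 * p + 1 + 1 by ring, twistedPowerMap_succ_xy, ih,
      twistIter_odd_succ h, twistIter_odd_succ h, twistIter_odd_succ h,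
      twistedPowerMap_odd_gx h, twistedPowerMap_odd_gy h, hM.1, hM.2, Matrix.det_fin_two,
      Matrix.trace_fin_two]
    simp only [mul_add, add_mul, mul_smul_comm, smul_mul_assoc, x_mul_x, y_mul_y, y_mul_x,
      x_mul_g_mul, y_mul_g_mul, mul_neg, Nat.cast_succ, mul_zero]
    module

theorem twistedPowerMap_odd_gxy (h : τ.trans τ = BialgEquiv.refl k (A k)) (hM : IsMatrixOf τ M)
    (p : ℕ) : twistedPowerMap τ (2 * p + 1) (g k * (x k * y k)) =
      (p ^ 2 + (p + 1) ^ 2 * M.det : k) • (g k * (x k * y k)) +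
        (p * (p + 1) * M.trace : k) • (x k * y k) := by
  induction p with
  | zero =>
    rw [twistedPowerMap_succ_gxy, twistIter_odd h, hM.map_xy, twistedPowerMap_even_g]
    simp [twistedPowerMap_zero_of_counit, counitHom_x, counitHom_y]
  | succ p ih =>
    rw [twistedPowerMap_succ_gxy, twistIter_odd h, twistIter_odd h, twistIter_odd h, hM.map_xy,
      twistedPowerMap_even_x h, twistedPowerMap_even_y h, twistedPowerMap_even_g, hM.1, hM.2,
      show 2 * (p + 1) = 2 * p + 1 + 1 by ring, twistedPowerMap_succ_gxy, ih,
      twistIter_odd_succ h, twistIter_odd_succ h, twistIter_odd_succ h, twistedPowerMap_odd_g,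
      twistedPowerMap_odd_x h, twistedPowerMap_odd_y h, hM.1, hM.2, Matrix.det_fin_two,
      Matrix.trace_fin_two]
    simp only [mul_add, add_mul, mul_sub, mul_smul_comm, smul_mul_assoc, x_mul_x,
      y_mul_y, y_mul_x, y_mul_g, mul_assoc, x_mul_g_mul, y_mul_g_mul, g_mul_g_mul, Nat.cast_succ,
      mul_zero, mul_one, mul_neg, neg_neg]
    module

theorem twistedIndicator_of_involution [CharZero k] (h : τ.trans τ = BialgEquiv.refl k (A k))
    (hM : IsMatrixOf τ M) {m : ℕ} (hm : 0 < m) (hm' : Even m) :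
    twistedIndicator m τ = (m : k) ^ 2 / 2 * (1 + M.det) := by
  -- The indicator uses `P_{m-1,τ}`, so `m` is written to make `m - 1 = 2p + 1` odd. The truncated
  -- `r - 1` is harmless since `m > 0`.
  obtain ⟨p, rfl⟩ : ∃ p, m = 2 * p + 1 + 1 := by
    obtain ⟨r, rfl⟩ := hm'
    exact ⟨r - 1, by omega⟩
  rw [twistedIndicator, Nat.add_sub_cancel, trace_antipode_comp, twistedPowerMap_one,
    twistedPowerMap_odd_g, twistedPowerMap_odd_x h, twistedPowerMap_odd_y h,
    twistedPowerMap_odd_gx h, twistedPowerMap_odd_gy h, twistedPowerMap_odd_xy h hM,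
    twistedPowerMap_odd_gxy h hM, hM.1, hM.2]
  simp [mul_add, coord_one, coord_x, coord_y, coord_xy, coord_g, coord_gx, coord_gy, coord_gxy]
  ring

theorem IsMatrixOf.det_of_involution (h : τ.trans τ = BialgEquiv.refl k (A k))
    (hM : IsMatrixOf τ M) : M.det = 1 ∨ M.det = -1 := by
  have h1 : M * M = 1 := ((hM.mul hM).eq_iff isMatrixOf_refl).1 h
  have h2 := congrArg Matrix.det h1
  rw [Matrix.det_mul, Matrix.det_one] at h2
  exact mul_self_eq_one_iff.1 h2

end Involution

/-! ### The third indicator. -/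

section OrderThree

variable {k : Type u} [Field k] {τ : A k ≃ₐc[k] A k} {M : Matrix (Fin 2) (Fin 2) k}

theorem twistedIndicator_three (hM : IsMatrixOf τ M) :
    twistedIndicator 3 τ = (M.trace + M.det) ^ 2 + (M.trace + 1) * (1 - M.det) := by
  have h0 : ∀ a, twistIter τ 0 a = a := fun _ => rfl
  rw [twistedIndicator, trace_antipode_comp]
  -- Writing the index `3 - 1` as `0 + 1 + 1` lets the successor recursions apply twice.
  change coord k (twistedPowerMap τ (0 + 1 + 1) _) _ - coord k (twistedPowerMap τ (0 + 1 + 1) _) _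
    - coord k (twistedPowerMap τ (0 + 1 + 1) _) _ + coord k (twistedPowerMap τ (0 + 1 + 1) _) _
    + coord k (twistedPowerMap τ (0 + 1 + 1) _) _ + coord k (twistedPowerMap τ (0 + 1 + 1) _) _
    + coord k (twistedPowerMap τ (0 + 1 + 1) _) _ + coord k (twistedPowerMap τ (0 + 1 + 1) _) _ = _
  have e0 := twistedPowerMap_even_g (τ := τ) 0
  have e1 := twistedPowerMap_zero_of_counit (τ := τ) (counitHom_x (k := k))
  have e2 := twistedPowerMap_zero_of_counit (τ := τ) (counitHom_y (k := k))
  have e3 : twistedPowerMap τ 0 (g k * x k) = 0 :=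
    twistedPowerMap_zero_of_counit (by simp [counitHom_x])
  have e4 : twistedPowerMap τ 0 (g k * y k) = 0 :=
    twistedPowerMap_zero_of_counit (by simp [counitHom_y])
  have e5 : twistedPowerMap τ 0 (x k * y k) = 0 :=
    twistedPowerMap_zero_of_counit (by simp [counitHom_y])
  have e6 : twistedPowerMap τ 0 (g k * (x k * y k)) = 0 :=
    twistedPowerMap_zero_of_counit (by simp [counitHom_y])
  rw [mul_zero] at e0
  simp only [twistedPowerMap_one, twistedPowerMap_succ_g, twistedPowerMap_succ_x,
    twistedPowerMap_succ_y, twistedPowerMap_succ_gx, twistedPowerMap_succ_gy,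
    twistedPowerMap_succ_xy, twistedPowerMap_succ_gxy, e0, e1, e2, e3, e4, e5, e6,
    twistIter_succ_apply, h0, hM.map_xy, hM.1, hM.2, map_add, map_smul]
  simp only [mul_add, add_mul, mul_smul_comm, smul_mul_assoc, x_mul_x,
    y_mul_y, y_mul_x, x_mul_g, y_mul_g, mul_assoc, x_mul_g_mul, y_mul_g_mul, g_mul_g_mul, g_mul_g,
    mul_zero, mul_one, mul_neg, neg_neg, add_zero, sub_zero, smul_add, smul_neg, smul_zero,
    map_add, map_sub, map_neg, map_smul, map_zero,
    coord_one, coord_x, coord_y, coord_xy, coord_gx, coord_gy, coord_gxy]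
  simp [Matrix.det_fin_two, Matrix.trace_fin_two]
  ring

/-- With `t = tr M` and `δ = det M`, Cayley–Hamilton gives `M³ = (t² - δ) M - tδ`. So `M³ = 1`
forces either `t² = δ` and `tδ = -1`, or `M` scalar. -/
theorem indicator_polynomial_eq_zero (h : M * M * M = 1) (hne : M ≠ 1) :
    (M.trace + M.det) ^ 2 + (M.trace + 1) * (1 - M.det) = 0 := by
  obtain ⟨a, b, c, d, rfl⟩ : ∃ a b c d, M = !![a, b; c, d] :=
    ⟨_, _, _, _, Matrix.eta_fin_two M⟩
  rw [Matrix.det_fin_two_of, Matrix.trace_fin_two_of]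
  rw [Matrix.mul_fin_two, Matrix.mul_fin_two, Matrix.one_fin_two] at h
  have h00 := congrFun (congrFun h 0) 0
  have h01 := congrFun (congrFun h 0) 1
  have h10 := congrFun (congrFun h 1) 0
  have h11 := congrFun (congrFun h 1) 1
  simp only [Matrix.of_apply, Matrix.cons_val_zero, Matrix.cons_val_one, Matrix.cons_val',
    Matrix.cons_val_fin_one] at h00 h01 h10 h11
  by_cases hs : (a + d) ^ 2 = a * d - b * c
  · have ht : (a + d) * (a * d - b * c) = -1 := by
      linear_combination a * hs - h00
    linear_combination (1 - (a * d - b * c)) * hs + (1 + a + d) * ht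
  · have key : (a + d) ^ 2 - (a * d - b * c) ≠ 0 := sub_ne_zero.2 hs
    -- The entries of `M³ = 1` give `(t² - δ)` times `b`, `c` and `a - d` equal to zero, so `M` is
    -- the scalar `a`.
    have hb : b = 0 := (mul_eq_zero.1 (show ((a + d) ^ 2 - (a * d - b * c)) * b = 0 by
      linear_combination h01)).resolve_left key
    have hc : c = 0 := (mul_eq_zero.1 (show ((a + d) ^ 2 - (a * d - b * c)) * c = 0 by
      linear_combination h10)).resolve_left key
    have hd : a - d = 0 := (mul_eq_zero.1 (show ((a + d) ^ 2 - (a * d - b * c)) * (a - d) = 0 by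
      linear_combination h00 - h11)).resolve_left key
    obtain rfl : a = d := sub_eq_zero.1 hd
    subst hb hc
    have ha : a - 1 ≠ 0 := fun h1 => hne (by
      rw [sub_eq_zero.1 h1, Matrix.one_fin_two])
    have h3 : a ^ 2 + a + 1 = 0 := (mul_eq_zero.1 (show (a - 1) * (a ^ 2 + a + 1) = 0 by
      linear_combination h00)).resolve_left ha
    -- With `t = 2a` and `δ = a²` the polynomial is `(a² + a + 1)²`.
    linear_combination (a ^ 2 + a + 1) * h3

end OrderThree

end Pointed8

theorem proposition6p2 (k : Type*) [Field k] [IsAlgClosed k] [CharZero k] :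
    Module.finrank k (Pointed8.A k) = 8 ∧
    ∀ τ : Pointed8.A k ≃ₐc[k] Pointed8.A k,
      (∃! M : Matrix (Fin 2) (Fin 2) k, Pointed8.IsMatrixOf τ M) ∧
      ∀ M : Matrix (Fin 2) (Fin 2) k, Pointed8.IsMatrixOf τ M →
        M.det ≠ 0 ∧
        (τ.trans τ = BialgEquiv.refl k (Pointed8.A k) →
          (M.det = 1 ∨ M.det = -1) ∧
          ∀ m : ℕ, 0 < m → Even m →
            twistedIndicator m τ = (m : k) ^ 2 / 2 * (1 + M.det) ∧
            (M.det = 1 → twistedIndicator m τ = (m : k) ^ 2) ∧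
            (M.det = -1 → twistedIndicator m τ = 0)) ∧
        ((τ.trans τ).trans τ = BialgEquiv.refl k (Pointed8.A k) →
          twistedIndicator 3 τ =
            (M.trace + M.det) ^ 2 + (M.trace + 1) * (1 - M.det) ∧
          (τ = BialgEquiv.refl k (Pointed8.A k) → twistedIndicator 3 τ = 9) ∧
          (τ ≠ BialgEquiv.refl k (Pointed8.A k) → twistedIndicator 3 τ = 0)) := by
  refine ⟨?_, fun τ => ⟨Pointed8.existsUnique_isMatrixOf τ, fun M hM => ⟨hM.det_ne_zero,
    fun h => ⟨hM.det_of_involution h, fun m hm hm' => ?_⟩, fun h => ?_⟩⟩⟩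
  · rw [Module.finrank_eq_card_basis (Pointed8.monomialBasis k), Fintype.card_fin]
  · have key := Pointed8.twistedIndicator_of_involution h hM hm hm'
    refine ⟨key, fun h1 => ?_, fun h1 => ?_⟩
    · rw [key, h1]; ring
    · rw [key, h1]; ring
  · have key := Pointed8.twistedIndicator_three hM
    refine ⟨key, fun h1 => ?_, fun h1 => ?_⟩
    · rw [key, (hM.eq_iff Pointed8.isMatrixOf_refl).1 h1, Matrix.trace_one, Matrix.det_one]
      norm_num
    · rw [key]
      exact Pointed8.indicator_polynomial_eq_zero
        ((((hM.mul hM).mul hM).eq_iff Pointed8.isMatrixOf_refl).1 h)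
        fun hM1 => h1 ((hM.eq_iff Pointed8.isMatrixOf_refl).2 hM1)
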